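/- Let $F$ be a finite field with $q$ elements, let $E$ be a quadratic extension of $F$, and let $G=\mathrm{GL}(2,F)$. Fix an $F$-basis of $E$ and let $K\subset G$ be the Coxeter (non-split) torus, that is, the subgroup of the matrices $m_z$ ($z\in E^\times$) of the maps $w\mapsto zw$ of $E$ in this basis. All representations are complex. For every character $\Phi\colon K\to\mathbb{C}^\times$, the induced representation $\mathrm{Ind}_K^G\Phi$ is multiplicity-free: for every irreducible representation $\pi$ of $G$, the multiplicity $m_\Phi(\pi)=\dim\mathrm{Hom}_G(\pi,\mathrm{Ind}_K^G\Phi)$ is at most $1$. Moreover, for every irreducible representation $\pi$ of $G$ with character $\chi_\pi$, there are two virtual representations $\psi_1,\psi_2$ of $G$ (formal differences of finite-dimensional representations), with characters $\chi_{\psi_1},\chi_{\psi_2}$, such that $$\bigl(\Phi(k)^{-1}+\Phi(k)^{-q}\bigr)\,\chi_\pi(k)=\chi_{\psi_1}(k)+\chi_{\psi_2}(k)\qquad\text{for all }k\in K,$$ and $m_\Phi(\pi)$ is the average of their multiplicities in $\mathrm{Ind}_K^G\mathbf 1$: $$m_\Phi(\pi)=\tfrac12\bigl(m_{\mathbf 1}(\psi_1)+m_{\mathbf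 1}(\psi_2)\bigr),$$ where $m_{\mathbf 1}(\rho)=\dim\mathrm{Hom}_G(\rho,\mathrm{Ind}_K^G\mathbf 1)$ for a representation $\rho$, extended additively to virtual representations. -/

import Mathlib

noncomputable section

namespace CoxeterTorus

/-- The Coxeter (non-split) torus of `GL(2, F)`: the subgroup of all matrices, with respect to the
`F`-basis `b` of the quadratic extension `E`, of the maps `w ↦ z * w` with `z ∈ Eˣ`. -/
def coxeterTorus {F E : Type*} [Field F] [Field E] [Algebra F E]
    (b : Module.Basis (Fin 2) F E) : Subgroup (Matrix.GeneralLinearGroup (Fin 2) F) :=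
  (Units.map (Algebra.leftMulMatrix b : E →* Matrix (Fin 2) (Fin 2) F)).range

/-- The one-dimensional complex representation given by a linear character. -/
def charRep {K : Type*} [Group K] (Φ : K →* ℂˣ) : Representation ℂ K ℂ :=
  ((Algebra.lmul ℂ ℂ : ℂ →ₐ[ℂ] Module.End ℂ ℂ) : ℂ →* Module.End ℂ ℂ).comp
    ((Units.coeHom ℂ).comp Φ)

/-- The representation of `G` induced from the linear character `Φ` of the subgroup `K`. -/
abbrev indChar {G : Type*} [Group G] (K : Subgroup G) (Φ : K →* ℂˣ) :
    Representation ℂ G (Representation.IndV K.subtype (charRep Φ)) :=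
  Representation.ind K.subtype (charRep Φ)

/-- `dim Hom_G(π, σ)`: for `π` irreducible this is the multiplicity of `π` in `σ`, and it is
additive in `π`, so that it is the multiplicity in `σ` of a general representation `π`. -/
def mult {G V W : Type*} [Group G] [AddCommGroup V] [Module ℂ V] [AddCommGroup W] [Module ℂ W]
    (π : Representation ℂ G V) (σ : Representation ℂ G W) : ℕ :=
  Module.finrank ℂ (Representation.IntertwiningMap π σ)

/-- A (finite-dimensional) representation is multiplicity-free if every irreducible
representation occurs in it at most once. -/
def IsMultiplicityFree.{w, u, v} {G : Type u} {W : Type v} [Group G] [AddCommGroup W] [Module ℂ W]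
    (σ : Representation ℂ G W) : Prop :=
  ∀ (V : Type w) [AddCommGroup V] [Module ℂ V] [FiniteDimensional ℂ V]
    (π : Representation ℂ G V), π.IsIrreducible → mult π σ ≤ 1

/-- A virtual representation: a formal difference of two finite-dimensional representations. -/
structure VirtualRep (G : Type*) [Group G] where
  /-- The representation that is counted positively. -/
  pos : FDRep ℂ G
  /-- The representation that is counted negatively. -/
  neg : FDRep ℂ G

/-- The character of a virtual representation. -/
def VirtualRep.character {G : Type*} [Group G] (ψ : VirtualRep G) (g : G) : ℂ :=
  ψ.pos.character g - ψ.neg.character g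

/-- The multiplicity of a virtual representation in `σ`, by additivity. -/
def VirtualRep.mult {G W : Type*} [Group G] [AddCommGroup W] [Module ℂ W]
    (ψ : VirtualRep G) (σ : Representation ℂ G W) : ℤ :=
  (CoxeterTorus.mult ψ.pos.ρ σ : ℤ) - (CoxeterTorus.mult ψ.neg.ρ σ : ℤ)

end CoxeterTorus

end

universe w

/-! Multiplicity one is Gelfand's trick. Every 2 × 2 matrix is uniquely `w ↦ a w + c σ w`, with `σ`
the Frobenius of `E` over `F`. The map `(a, c) ↦ (a, σ c)` is an anti-automorphism that fixes `K`
and moves each element within its `K`-conjugacy class. Hence the operators `P π(g) P`, with `P` the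
projection to the `Φ`-eigenspace of `K`, commute (`commute_hecke`). For irreducible `π` the
eigenspace is then at most a line, and Frobenius reciprocity identifies its dimension with the
multiplicity.

For the averaging formula, `Φ⁻¹ + Φ⁻ᵠ` on `K` is the restriction of a virtual character of `G`: that
of the representation induced from `Φ⁻¹`, minus `q - 2` times a principal series character
(`character_torusInduced_sub`). Tensoring with `π` gives `ψ₁` and `ψ₂`. Averaging over `K` turns
both sides into multiplicities. The terms `Φ⁻¹` and `Φ⁻ᵠ` contribute equally because `k ↦ k ^ q` on
`K` is conjugation by an element of `G` (`sum_inv_pow_mul_character`), whence the factor 1/2. -/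

noncomputable section

namespace CoxeterTorus

open Module

/-! ### Frobenius reciprocity and multiplicities as averages over the subgroup. -/

section Frobenius

variable {G V : Type*} [Group G] [AddCommGroup V] [Module ℂ V]

@[simp]
lemma charRep_apply {K : Type*} [Group K] (Φ : K →* ℂˣ) (k : K) (z : ℂ) :
    charRep Φ k z = (Φ k : ℂ) * z := rfl

lemma character_charRep {K : Type*} [Group K] (Φ : K →* ℂˣ) (k : K) :
    (charRep Φ).character k = (Φ k : ℂ) := by
  have : charRep Φ k = (Φ k : ℂ) • LinearMap.id := by ext; simp
  rw [Representation.character, this]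
  simp

/-- Frobenius reciprocity for the representation induced from a linear character. -/
def indCharHomEquiv (K : Subgroup G) (Φ : K →* ℂˣ) (π : Representation ℂ G V) :
    Representation.IntertwiningMap (indChar K Φ) π ≃ₗ[ℂ]
      Representation.IntertwiningMap (charRep Φ) (π.comp K.subtype) where
  toFun f := ⟨f.toLinearMap ∘ₗ Representation.IndV.mk K.subtype (charRep Φ) 1, fun g ↦ by
    ext
    have := f.isIntertwining _ _ (g : G) (Representation.IndV.mk K.subtype (charRep Φ) 1 1)
    have h := Representation.Coinvariants.mk_self_apply
      (Representation.tprod ((Representation.leftRegular ℂ G).comp K.subtype) (charRep Φ)) g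
      (TensorProduct.tmul ℂ (.single (g : G)⁻¹ 1) 1)
    simp_all⟩
  map_add' _ _ := rfl
  map_smul' _ _ := rfl
  -- In this model of the induced representation, the class of `h ⊗ z` is the translate by `h⁻¹` of
  -- the class of `1 ⊗ z`.
  invFun f := ⟨Representation.Coinvariants.lift _
    (TensorProduct.lift <| (Finsupp.lift _ _ _ fun h => π h⁻¹ ∘ₗ f.toLinearMap) ∘ₗ
      (MonoidAlgebra.coeffLinearEquiv ℂ).toLinearMap)
    fun g ↦ by
      ext h
      have := f.isIntertwining _ _ g 1
      simp_all, fun g ↦ by ext; simp⟩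
  left_inv f := by
    ext h
    have := f.isIntertwining _ _ h⁻¹ (Representation.IndV.mk K.subtype (charRep Φ) 1 1)
    simp_all
  right_inv f := by ext; simp

variable [FiniteDimensional ℂ V]

/-- The pairing of characters is symmetric under `g ↦ g⁻¹`. This reconciles `Hom(π, Ind Φ)` in
`mult` with `Hom(Ind Φ, π)` in `indCharHomEquiv`. -/
lemma finrank_intertwiningMap_comm {W : Type*} [AddCommGroup W] [Module ℂ W]
    [FiniteDimensional ℂ W] [Finite G] (π : Representation ℂ G V) (σ : Representation ℂ G W) :
    finrank ℂ (Representation.IntertwiningMap π σ) =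
      finrank ℂ (Representation.IntertwiningMap σ π) := by
  have := Fintype.ofFinite G
  have : Invertible (Nat.card G : ℂ) := invertibleOfNonzero (by simp)
  rw [← Nat.cast_inj (R := ℂ), ← Representation.card_inv_mul_sum_char_mul_char_eq_finrank,
    ← Representation.card_inv_mul_sum_char_mul_char_eq_finrank]
  congr 1
  refine Fintype.sum_equiv (Equiv.inv G) _ _ fun g => ?_
  simp [mul_comm]

lemma mult_indChar [Finite G] (K : Subgroup G) (Φ : K →* ℂˣ) (π : Representation ℂ G V) :
    mult π (indChar K Φ) =
      finrank ℂ (Representation.IntertwiningMap (charRep Φ) (π.comp K.subtype)) := by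
  have : FiniteDimensional ℂ (MonoidAlgebra ℂ G) :=
    Module.Finite.equiv (MonoidAlgebra.coeffLinearEquiv ℂ).symm
  have : FiniteDimensional ℂ (Representation.IndV K.subtype (charRep Φ)) :=
    inferInstance
  rw [mult, finrank_intertwiningMap_comm, (indCharHomEquiv K Φ π).finrank_eq]

lemma mult_indChar_eq_sum [Finite G] (K : Subgroup G) [Fintype K] (Φ : K →* ℂˣ)
    (π : Representation ℂ G V) :
    (mult π (indChar K Φ) : ℂ) =
      (Nat.card K : ℂ)⁻¹ * ∑ k : K, ((Φ k)⁻¹ : ℂˣ) * π.character k := by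
  have : Invertible (Nat.card K : ℂ) := invertibleOfNonzero (by simp)
  rw [mult_indChar, ← Representation.card_inv_mul_sum_char_mul_char_eq_finrank]
  congr 1
  refine Finset.sum_congr rfl fun k _ => ?_
  rw [character_charRep, mul_comm, map_inv]
  rfl

end Frobenius

/-! ### Gelfand's trick and multiplicity one. -/

section Gelfand

variable {G V : Type*} [Group G] [AddCommGroup V] [Module ℂ V]

/-- The eigenspace of a linear character of a subgroup. -/
def eigenspace (K : Subgroup G) (Φ : K →* ℂˣ) (π : Representation ℂ G V) : Submodule ℂ V where
  carrier := {v | ∀ k : K, π k v = (Φ k : ℂ) • v}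
  add_mem' hu hv k := by simp [hu k, hv k]
  zero_mem' k := by simp
  smul_mem' c v hv k := by simp [hv k, smul_comm c]

/-- The projection to the eigenspace of a linear character of a finite subgroup. -/
def eigenproj (K : Subgroup G) [Fintype K] (Φ : K →* ℂˣ) (π : Representation ℂ G V) : End ℂ V :=
  (Nat.card K : ℂ)⁻¹ • ∑ k : K, ((Φ k)⁻¹ : ℂˣ) • π k

variable (K : Subgroup G) [Fintype K] (Φ : K →* ℂˣ) (π : Representation ℂ G V)

lemma rho_mul_eigenproj (k : K) : π k * eigenproj K Φ π = (Φ k : ℂ) • eigenproj K Φ π := by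
  simp only [eigenproj, mul_smul_comm, Finset.mul_sum, Finset.smul_sum]
  refine Fintype.sum_equiv (Equiv.mulLeft k) _ _ fun l => ?_
  simp only [Equiv.coe_mulLeft, map_mul, Subgroup.coe_mul, mul_inv, Units.smul_def, smul_smul,
    Units.val_mul, Units.val_inv_eq_inv_val]
  congr 1
  have := (Φ k).ne_zero
  field_simp

lemma eigenproj_mul_rho (k : K) : eigenproj K Φ π * π k = (Φ k : ℂ) • eigenproj K Φ π := by
  simp only [eigenproj, smul_mul_assoc, Finset.sum_mul, Finset.smul_sum]
  refine Fintype.sum_equiv (Equiv.mulRight k) _ _ fun l => ?_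
  simp only [Equiv.coe_mulRight, map_mul, Subgroup.coe_mul, mul_inv, Units.smul_def, smul_smul,
    Units.val_mul, Units.val_inv_eq_inv_val]
  congr 1
  have := (Φ k).ne_zero
  field_simp

variable {Φ π} in
lemma eigenproj_apply {v : V} (hv : v ∈ eigenspace K Φ π) : eigenproj K Φ π v = v := by
  have h (k : K) : ((Φ k)⁻¹ : ℂˣ) • π k v = v := by
    rw [hv k, Units.smul_def, smul_smul, Units.inv_mul, one_smul]
  simp [eigenproj, h, ← Nat.cast_smul_eq_nsmul ℂ]

lemma eigenproj_mem (v : V) : eigenproj K Φ π v ∈ eigenspace K Φ π := fun k =>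
  LinearMap.congr_fun (rho_mul_eigenproj K Φ π k) v

/-- Gelfand's trick: an anti-automorphism moving every element within its `K`-conjugacy class and
fixing `K` makes the Hecke operators commute. -/
lemma commute_hecke (s : G → G) (hs : ∀ g h, s (g * h) = s h * s g) (hK : ∀ k ∈ K, s k = k)
    (hc : ∀ g, ∃ k ∈ K, s g = k * g * k⁻¹) (g h : G) :
    Commute (eigenproj K Φ π * π g * eigenproj K Φ π)
      (eigenproj K Φ π * π h * eigenproj K Φ π) := by
  set P := eigenproj K Φ π with hP
  have idem : P * P = P := LinearMap.ext fun v => eigenproj_apply K (eigenproj_mem K Φ π v)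
  -- The projection absorbs `k` and `k⁻¹` as the scalars `Φ k` and `(Φ k)⁻¹`, which cancel.
  have conj (x : G) : P * π (s x) * P = P * π x * P := by
    obtain ⟨k, hk, hx⟩ := hc x
    have h1 := eigenproj_mul_rho K Φ π ⟨k, hk⟩
    have h2 := rho_mul_eigenproj K Φ π ⟨k⁻¹, K.inv_mem hk⟩
    have h3 : Φ ⟨k⁻¹, K.inv_mem hk⟩ = (Φ ⟨k, hk⟩)⁻¹ := by
      rw [← map_inv]; rfl
    rw [h3] at h2
    simp only [← hP] at h1 h2
    calc P * π (s x) * P = (P * π k) * π x * (π k⁻¹ * P) := by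
          simp only [hx, map_mul, mul_assoc]
      _ = P * π x * P := by
          rw [h1, h2]
          simp [smul_smul]
  have expand (x y : G) : P * π x * P * (P * π y * P) =
      (Nat.card K : ℂ)⁻¹ • ∑ k : K, ((Φ k)⁻¹ : ℂˣ) • (P * π (x * k * y) * P) := by
    calc _ = P * π x * (P * P) * (π y * P) := by simp only [mul_assoc]
      _ = P * π x * eigenproj K Φ π * (π y * P) := by rw [idem]
      _ = _ := by
        simp only [eigenproj, mul_smul_comm, smul_mul_assoc, Finset.mul_sum, Finset.sum_mul,
          map_mul, mul_assoc]
  have swap (x y : G) : P * π (s x) * P * (P * π (s y) * P) = P * π y * P * (P * π x * P) := by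
    rw [expand, expand]
    congr 1
    refine Finset.sum_congr rfl fun k _ => ?_
    rw [← conj (y * k * x), hs, hs, hK k k.2, mul_assoc (s x)]
  have := swap h g
  rw [conj, conj] at this
  exact this.symm

variable {π} in
lemma span_orbit_eq_top (hπ : π.IsIrreducible) {v : V} (hv : v ≠ 0) :
    Submodule.span ℂ (Set.range fun g => π g v) = ⊤ := by
  let S : Subrepresentation π :=
    ⟨Submodule.span ℂ (Set.range fun g => π g v), fun g w hw => by
      induction hw using Submodule.span_induction with
      | mem x hx =>
        obtain ⟨h, rfl⟩ := hx
        exact Submodule.subset_span ⟨g * h, by simp⟩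
      | zero => simp
      | add x y _ _ hx hy => simpa using add_mem hx hy
      | smul c x _ hx => simpa using Submodule.smul_mem _ c hx⟩
  have hmem : v ∈ S.toSubmodule := Submodule.subset_span ⟨1, by simp⟩
  rcases hπ.eq_bot_or_eq_top S with h | h
  · rw [h] at hmem
    exact absurd hmem hv
  · exact congrArg Subrepresentation.toSubmodule h

/-- A Gelfand-type criterion: `K`-eigenspaces of irreducible representations are lines. -/
lemma eigenspace_le_span [FiniteDimensional ℂ V] (hπ : π.IsIrreducible) (s : G → G)
    (hs : ∀ g h, s (g * h) = s h * s g) (hK : ∀ k ∈ K, s k = k)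
    (hc : ∀ g, ∃ k ∈ K, s g = k * g * k⁻¹) {u : V} (hu : u ∈ eigenspace K Φ π) (hu0 : u ≠ 0) :
    eigenspace K Φ π ≤ Submodule.span ℂ {u} := by
  set P := eigenproj K Φ π with hP
  -- By irreducibility the orbit of `w` spans `V`, so its image under `P` spans the eigenspace.
  have cyclic (w : V) (hw0 : w ≠ 0) (W : Submodule ℂ V) (hW : ∀ g, P (π g w) ∈ W) :
      eigenspace K Φ π ≤ W := fun v hv => by
    have : Submodule.span ℂ (Set.range fun g => π g w) ≤ W.comap P := by
      rw [Submodule.span_le]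
      rintro _ ⟨g, rfl⟩
      exact hW g
    rw [span_orbit_eq_top hπ hw0] at this
    have := this (Submodule.mem_top (x := v))
    rwa [Submodule.mem_comap, hP, eigenproj_apply K hv] at this
  refine cyclic u hu0 _ fun g => ?_
  have hres : ∀ v ∈ eigenspace K Φ π, (P * π g * P) v ∈ eigenspace K Φ π :=
    fun v _ => eigenproj_mem K Φ π _
  have : Nontrivial (eigenspace K Φ π) := ⟨⟨⟨u, hu⟩, 0, fun h => hu0 (congrArg Subtype.val h)⟩⟩
  obtain ⟨c, hcev⟩ := Module.End.exists_eigenvalue ((P * π g * P).restrict hres)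
  obtain ⟨⟨w, hw⟩, hwc⟩ := hcev.exists_hasEigenvector
  have hw0 : w ≠ 0 := fun h => hwc.2 (Subtype.ext h)
  have hwe : (P * π g * P) w = c • w := congrArg Subtype.val hwc.apply_eq_smul
  -- By commutativity, `P π(g) P - c` kills every `P π(h) w` because it kills `w`. These vectors
  -- span the eigenspace, so `P π(g) P` acts there as the scalar `c`.
  have : u ∈ LinearMap.ker (P * π g * P - c • 1) := by
    refine cyclic w hw0 _ (fun h => ?_) hu
    have hcomm := LinearMap.congr_fun (commute_hecke K Φ π s hs hK hc g h).eq w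
    have hPw : P w = w := eigenproj_apply K hw
    have e : (P * π h * P) w = P (π h w) := by simp [hPw]
    rw [← hP, Module.End.mul_apply (P * π g * P), Module.End.mul_apply (P * π h * P), hwe,
      map_smul, e] at hcomm
    simp [LinearMap.mem_ker, sub_eq_zero] at hcomm ⊢
    exact hcomm
  rw [LinearMap.mem_ker] at this
  have hPu : P u = u := eigenproj_apply K hu
  simp only [LinearMap.sub_apply, Module.End.mul_apply, hPu, LinearMap.smul_apply,
    Module.End.one_apply, sub_eq_zero] at this
  rw [this]
  exact Submodule.smul_mem _ _ (Submodule.mem_span_singleton_self u)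

/-- An intertwiner out of `charRep Φ` is determined by its value at `1`, which lies in the
eigenspace. -/
lemma mult_indChar_le_one [Finite G] [FiniteDimensional ℂ V] (hπ : π.IsIrreducible) (s : G → G)
    (hs : ∀ g h, s (g * h) = s h * s g) (hK : ∀ k ∈ K, s k = k)
    (hc : ∀ g, ∃ k ∈ K, s g = k * g * k⁻¹) : mult π (indChar K Φ) ≤ 1 := by
  rw [mult_indChar]
  by_cases h : ∀ f : Representation.IntertwiningMap (charRep Φ) (π.comp K.subtype), f = 0
  · have : Subsingleton (Representation.IntertwiningMap (charRep Φ) (π.comp K.subtype)) :=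
      ⟨fun a b => (h a).trans (h b).symm⟩
    rw [finrank_zero_of_subsingleton]
    exact zero_le_one
  push Not at h
  obtain ⟨f, hf⟩ := h
  have mem (f : Representation.IntertwiningMap (charRep Φ) (π.comp K.subtype)) :
      f 1 ∈ eigenspace K Φ π := fun k => by
    have h1 := f.isIntertwining _ _ k 1
    have h2 : charRep Φ k 1 = (Φ k : ℂ) • (1 : ℂ) := rfl
    rw [h2, map_smul] at h1
    exact h1.symm
  have inj (f f' : Representation.IntertwiningMap (charRep Φ) (π.comp K.subtype))
      (h : f 1 = f' 1) : f = f' := by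
    ext
    exact h
  refine finrank_le_one f fun f' => ?_
  have := eigenspace_le_span K Φ π hπ s hs hK hc (mem f) (fun h => hf (inj _ _ h)) (mem f')
  obtain ⟨c, hc⟩ := Submodule.mem_span_singleton.1 this
  exact ⟨c, inj _ _ hc⟩

end Gelfand

/-! ### Representations on equivariant functions and their characters. -/

section EquivariantFunctions

variable {G A X : Type*} [Group G] [Group A]

/-- The functions on `X` that transform by the linear character `χ` under the action `α`. -/
def equivariantFun (α : A →* Equiv.Perm X) (χ : A →* ℂˣ) : Submodule ℂ (X → ℂ) where
  carrier := {f | ∀ a x, f (α a x) = (χ a : ℂ) * f x}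
  add_mem' hf hg a x := by simp [hf a x, hg a x, mul_add]
  zero_mem' a x := by simp
  smul_mem' c f hf a x := by simp [hf a x, mul_left_comm c]

/-- The action of `G` by translation on the functions on `X` that transform by `χ`. -/
def equivariantRep (ρ : G →* Equiv.Perm X) (α : A →* Equiv.Perm X) (χ : A →* ℂˣ)
    (hc : ∀ g a, Commute (ρ g) (α a)) : Representation ℂ G (equivariantFun α χ) where
  toFun g := (LinearMap.funLeft ℂ ℂ (ρ g⁻¹)).restrict fun f hf a x => by
    have : ρ g⁻¹ (α a x) = α a (ρ g⁻¹ x) := DFunLike.congr_fun (hc g⁻¹ a).eq x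
    rw [LinearMap.funLeft_apply, LinearMap.funLeft_apply, this, hf a]
  map_one' := by ext; simp [LinearMap.funLeft_apply]
  map_mul' g h := by ext; simp [LinearMap.funLeft_apply]

/-- The averaging projection `p` onto the equivariant functions lets the trace be computed on all
functions on `X`, where the delta functions form a basis and the trace of each summand counts
points. -/
lemma character_equivariantRep [Fintype A] [Fintype X] [DecidableEq X] (ρ : G →* Equiv.Perm X)
    (α : A →* Equiv.Perm X) (χ : A →* ℂˣ) (hc : ∀ g a, Commute (ρ g) (α a)) (g : G) :
    (equivariantRep ρ α χ hc).character g = (Nat.card A : ℂ)⁻¹ *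
      ∑ a : A, ((χ a)⁻¹ : ℂˣ) * (Fintype.card {x // α a x = ρ g x} : ℂ) := by
  let p : (X → ℂ) →ₗ[ℂ] (X → ℂ) :=
    (Nat.card A : ℂ)⁻¹ • ∑ a : A, (((χ a)⁻¹ : ℂˣ) : ℂ) • LinearMap.funLeft ℂ ℂ (α a)
  have p_apply (f : X → ℂ) (x : X) :
      p f x = (Nat.card A : ℂ)⁻¹ * ∑ a : A, (((χ a)⁻¹ : ℂˣ) : ℂ) * f (α a x) := by
    simp [p, LinearMap.funLeft_apply]
  have hp (f : X → ℂ) : p f ∈ equivariantFun α χ := fun b x => by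
    rw [p_apply, p_apply, mul_left_comm]
    congr 1
    rw [Finset.mul_sum]
    refine Fintype.sum_equiv (Equiv.mulRight b) _ _ fun a => ?_
    simp only [Equiv.coe_mulRight, map_mul, mul_inv, Equiv.Perm.mul_apply, Units.val_mul]
    rw [← mul_assoc, mul_comm (χ b : ℂ), mul_assoc ((χ a)⁻¹ : ℂˣ).val, Units.inv_mul, mul_one]
  have hp' (f : equivariantFun α χ) : p f = f := by
    ext x
    have h (a : A) : (((χ a)⁻¹ : ℂˣ) : ℂ) * (f : X → ℂ) (α a x) = (f : X → ℂ) x := by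
      rw [f.2 a x, ← mul_assoc, Units.inv_mul, one_mul]
    rw [p_apply, Finset.sum_congr rfl fun a _ => h a]
    simp
  let P : (X → ℂ) →ₗ[ℂ] equivariantFun α χ := p.codRestrict _ hp
  have hP : P ∘ₗ (equivariantFun α χ).subtype = LinearMap.id := by
    ext f x
    exact congrFun (hp' f) x
  have h1 : equivariantRep ρ α χ hc g =
      (equivariantRep ρ α χ hc g ∘ₗ P) ∘ₗ (equivariantFun α χ).subtype := by
    rw [LinearMap.comp_assoc, hP, LinearMap.comp_id]
  have h2 : (equivariantFun α χ).subtype ∘ₗ (equivariantRep ρ α χ hc g ∘ₗ P) =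
      LinearMap.funLeft ℂ ℂ (ρ g⁻¹) ∘ₗ p := rfl
  rw [Representation.character, h1, LinearMap.trace_comp_comm', h2,
    LinearMap.trace_eq_matrix_trace ℂ (Pi.basisFun ℂ X), Matrix.trace]
  have h3 (a : A) (x : X) : α a (ρ g⁻¹ x) = x ↔ α a x = ρ g x := by
    have : α a (ρ g⁻¹ x) = ρ g⁻¹ (α a x) := (DFunLike.congr_fun (hc g⁻¹ a).eq x).symm
    rw [this, map_inv, Equiv.Perm.inv_eq_iff_eq]
  simp only [Matrix.diag_apply, LinearMap.toMatrix_apply, Pi.basisFun_apply, Pi.basisFun_repr,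
    LinearMap.comp_apply, LinearMap.funLeft_apply, p_apply, Pi.single_apply, h3]
  rw [← Finset.mul_sum, Finset.sum_comm]
  congr 1
  refine Finset.sum_congr rfl fun a _ => ?_
  rw [← Finset.mul_sum, Finset.sum_boole, Fintype.card_subtype]

/-- A finite-dimensional representation in any universe, as an object of `FDRep`. -/
lemma exists_fdRep_character {V : Type*} [AddCommGroup V] [Module ℂ V] [FiniteDimensional ℂ V]
    (π : Representation ℂ G V) : ∃ U : FDRep ℂ G, ∀ g, U.character g = π.character g := by
  let e := (finBasis ℂ V).equivFun
  refine ⟨FDRep.of ((e.conjRingEquiv : End ℂ V →* End ℂ (Fin (finrank ℂ V) → ℂ)).comp π),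
    fun g => ?_⟩
  exact LinearMap.trace_conj' (π g) e

end EquivariantFunctions

/-! ### The quadratic extension, semilinear coordinates and the anti-automorphism. -/

section Quadratic

open Matrix

variable {F E : Type*} [Field F] [Field E] [Algebra F E]

lemma exists_frobenius [Finite F] (h : finrank F E = 2) : ∃ σ : E ≃ₐ[F] E,
    (∀ z, σ z = z ^ Nat.card F) ∧ (∀ z, σ (σ z) = z) ∧ ∃ w, σ w ≠ w := by
  have := Fintype.ofFinite F
  have : FiniteDimensional F E := .of_finrank_pos (by omega)
  have : Finite E := Module.finite_of_finite F
  have ho := FiniteField.orderOf_frobeniusAlgEquivOfAlgebraic F E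
  rw [h] at ho
  refine ⟨FiniteField.frobeniusAlgEquivOfAlgebraic F E, fun z => ?_, fun z => ?_, ?_⟩
  · rw [Nat.card_eq_fintype_card]
    rfl
  · have := pow_orderOf_eq_one (FiniteField.frobeniusAlgEquivOfAlgebraic F E)
    rw [ho, pow_two] at this
    exact DFunLike.congr_fun this z
  · by_contra! hw
    have : FiniteField.frobeniusAlgEquivOfAlgebraic F E = 1 := AlgEquiv.ext hw
    rw [this, orderOf_one] at ho
    omega

variable (σ : E ≃ₐ[F] E)

/-- The fixed space of `σ` is a proper subspace of a plane and contains `1`, so it is the line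
through `1`. -/
lemma exists_algebraMap_eq (h : finrank F E = 2) (hw : ∃ w, σ w ≠ w) {z : E} (hz : σ z = z) :
    ∃ a, algebraMap F E a = z := by
  have : FiniteDimensional F E := .of_finrank_pos (by omega)
  let S : Submodule F E := LinearMap.ker (σ.toLinearMap - LinearMap.id)
  have mem (x : E) : x ∈ S ↔ σ x = x := by simp [S, LinearMap.mem_ker, sub_eq_zero]
  have hS : S < ⊤ := by
    obtain ⟨w, hw⟩ := hw
    exact lt_top_iff_ne_top.2 fun h => hw ((mem w).1 (h ▸ Submodule.mem_top))
  have h1 := Submodule.finrank_lt hS.ne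
  have hone : (⟨1, (mem 1).2 (map_one σ)⟩ : S) ≠ 0 := fun h => one_ne_zero (congrArg Subtype.val h)
  have h2 : 0 < finrank F S := finrank_pos_iff_exists_ne_zero.2 ⟨_, hone⟩
  have h3 : finrank F S = 1 := by omega
  obtain ⟨c, hc⟩ := (finrank_eq_one_iff_of_nonzero' _ hone).1 h3 ⟨z, (mem z).2 hz⟩
  refine ⟨c, ?_⟩
  rw [Algebra.algebraMap_eq_smul_one]
  exact congrArg Subtype.val hc

variable (b : Basis (Fin 2) F E)

/-- The matrix of an automorphism of `E` over `F`. -/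
abbrev autMatrix : Matrix (Fin 2) (Fin 2) F := LinearMap.toMatrix b b σ.toLinearMap

lemma autMatrix_mul_leftMulMatrix (z : E) :
    autMatrix σ b * Algebra.leftMulMatrix b z =
      Algebra.leftMulMatrix b (σ z) * autMatrix σ b := by
  rw [autMatrix, Algebra.leftMulMatrix_apply, Algebra.leftMulMatrix_apply,
    ← LinearMap.toMatrix_comp, ← LinearMap.toMatrix_comp]
  congr 1
  ext
  simp

lemma autMatrix_mul_self (h2 : ∀ z, σ (σ z) = z) : autMatrix σ b * autMatrix σ b = 1 := by
  rw [autMatrix, ← LinearMap.toMatrix_comp, ← LinearMap.toMatrix_id b]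
  congr 1
  ext
  simp [h2]

/-- Every `2 × 2` matrix is the matrix of `w ↦ a * w + c * σ w` for a unique pair `(a, c)`. -/
def semilinearCoords (hw : ∃ w, σ w ≠ w) : (E × E) ≃ₗ[F] Matrix (Fin 2) (Fin 2) F :=
  have := Module.Finite.of_basis b
  LinearEquiv.ofInjectiveOfFinrankEq
    ((Algebra.leftMulMatrix b).toLinearMap.coprod
      ((LinearMap.mulRight F (autMatrix σ b)) ∘ₗ (Algebra.leftMulMatrix b).toLinearMap))
    (by
      rw [← LinearMap.ker_eq_bot, LinearMap.ker_eq_bot']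
      rintro ⟨a, c⟩ h
      have h' : LinearMap.toMatrix b b (Algebra.lmul F E a + Algebra.lmul F E c ∘ₗ σ.toLinearMap)
          = 0 := by
        rw [map_add, LinearMap.toMatrix_comp b b b]
        exact h
      rw [LinearEquiv.map_eq_zero_iff] at h'
      have key (w : E) : a * w + c * σ w = 0 := LinearMap.congr_fun h' w
      obtain ⟨w, hw⟩ := hw
      -- Testing at `1` and at a vector moved by `σ` separates the two coefficients.
      have h1 := key 1
      rw [map_one, mul_one, mul_one] at h1
      have hc : c * (σ w - w) = 0 := by linear_combination key w - w * h1
      have hc : c = 0 := (mul_eq_zero.1 hc).resolve_right (sub_ne_zero.2 hw)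
      subst hc
      simpa using h1)
    (by simp [finrank_matrix, finrank_eq_card_basis b])

lemma semilinearCoords_apply (hw : ∃ w, σ w ≠ w) (a c : E) :
    semilinearCoords σ b hw (a, c) =
      Algebra.leftMulMatrix b a + Algebra.leftMulMatrix b c * autMatrix σ b := rfl

lemma semilinearCoords_mul (hw : ∃ w, σ w ≠ w) (h2 : ∀ z, σ (σ z) = z) (a c a' c' : E) :
    semilinearCoords σ b hw (a, c) * semilinearCoords σ b hw (a', c') =
      semilinearCoords σ b hw (a * a' + c * σ c', a * c' + c * σ a') := by
  simp only [semilinearCoords_apply, map_add, map_mul, add_mul, mul_add]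
  have e1 : Algebra.leftMulMatrix b c * autMatrix σ b * Algebra.leftMulMatrix b a' =
      Algebra.leftMulMatrix b c * Algebra.leftMulMatrix b (σ a') * autMatrix σ b := by
    rw [mul_assoc, autMatrix_mul_leftMulMatrix, mul_assoc]
  have e2 : Algebra.leftMulMatrix b c * autMatrix σ b *
      (Algebra.leftMulMatrix b c' * autMatrix σ b) =
      Algebra.leftMulMatrix b c * Algebra.leftMulMatrix b (σ c') := by
    rw [mul_assoc, ← mul_assoc (autMatrix σ b), autMatrix_mul_leftMulMatrix, mul_assoc,
      autMatrix_mul_self σ b h2, mul_one]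
  rw [e1, e2, ← mul_assoc (Algebra.leftMulMatrix b a)]
  abel

lemma leftMulMatrix_eq_semilinearCoords (hw : ∃ w, σ w ≠ w) (z : E) :
    Algebra.leftMulMatrix b z = semilinearCoords σ b hw (z, 0) := by
  simp [semilinearCoords_apply]

/-- The anti-automorphism `(a, c) ↦ (a, σ c)` of the matrix algebra. -/
def antiAut (hw : ∃ w, σ w ≠ w) (x : Matrix (Fin 2) (Fin 2) F) : Matrix (Fin 2) (Fin 2) F :=
  semilinearCoords σ b hw
    (((semilinearCoords σ b hw).symm x).1, σ ((semilinearCoords σ b hw).symm x).2)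

lemma antiAut_semilinearCoords (hw : ∃ w, σ w ≠ w) (a c : E) :
    antiAut σ b hw (semilinearCoords σ b hw (a, c)) = semilinearCoords σ b hw (a, σ c) := by
  simp [antiAut]

lemma antiAut_mul (hw : ∃ w, σ w ≠ w) (h2 : ∀ z, σ (σ z) = z) (x y : Matrix (Fin 2) (Fin 2) F) :
    antiAut σ b hw (x * y) = antiAut σ b hw y * antiAut σ b hw x := by
  obtain ⟨⟨a, c⟩, rfl⟩ := (semilinearCoords σ b hw).surjective x
  obtain ⟨⟨a', c'⟩, rfl⟩ := (semilinearCoords σ b hw).surjective y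
  rw [semilinearCoords_mul σ b hw h2]
  simp only [antiAut_semilinearCoords]
  rw [semilinearCoords_mul σ b hw h2]
  simp only [map_add, map_mul, h2]
  congr 2 <;> ring

lemma antiAut_leftMulMatrix (hw : ∃ w, σ w ≠ w) (z : E) :
    antiAut σ b hw (Algebra.leftMulMatrix b z) = Algebra.leftMulMatrix b z := by
  rw [leftMulMatrix_eq_semilinearCoords σ b hw, antiAut_semilinearCoords, map_zero]

/-- The anti-automorphism `antiAut` on invertible matrices. -/
def unitsAntiAut (hw : ∃ w, σ w ≠ w) (h2 : ∀ z, σ (σ z) = z) (g : GL (Fin 2) F) :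
    GL (Fin 2) F where
  val := antiAut σ b hw g
  inv := antiAut σ b hw (g⁻¹ : GL (Fin 2) F)
  val_inv := by
    rw [← antiAut_mul σ b hw h2, Units.inv_mul]
    simpa using antiAut_leftMulMatrix σ b hw 1
  inv_val := by
    rw [← antiAut_mul σ b hw h2, Units.mul_inv]
    simpa using antiAut_leftMulMatrix σ b hw 1

/-- The isomorphism of `Eˣ` with the Coxeter torus. -/
def torusEquiv : Eˣ ≃* coxeterTorus b :=
  MonoidHom.ofInjective (f := Units.map (Algebra.leftMulMatrix b : E →* Matrix (Fin 2) (Fin 2) F))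
    (Units.map_injective (Algebra.leftMulMatrix_injective b))

@[simp]
lemma coe_torusEquiv (z : Eˣ) :
    ((torusEquiv b z : GL (Fin 2) F) : Matrix (Fin 2) (Fin 2) F) = Algebra.leftMulMatrix b z := rfl

lemma exists_conj_eq_unitsAntiAut (hw : ∃ w, σ w ≠ w) (h2 : ∀ z, σ (σ z) = z)
    (g : GL (Fin 2) F) : ∃ k ∈ coxeterTorus b, unitsAntiAut σ b hw h2 g = k * g * k⁻¹ := by
  obtain ⟨⟨a, c⟩, hg⟩ := (semilinearCoords σ b hw).surjective g
  by_cases hc : c = 0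
  · refine ⟨1, one_mem _, Units.ext ?_⟩
    change antiAut σ b hw g = _
    simp [← hg, hc, antiAut_semilinearCoords]
  -- Conjugation by `k` sends `(a, c)` to `(a, k c σ(k⁻¹))`, and `k = c⁻¹` turns the second entry
  -- into `σ c`.
  · refine ⟨torusEquiv b (Units.mk0 c hc)⁻¹, SetLike.coe_mem _, ?_⟩
    rw [eq_mul_inv_iff_mul_eq]
    refine Units.ext ?_
    rw [Units.val_mul, Units.val_mul, coe_torusEquiv, ← hg]
    change antiAut σ b hw g * _ = _
    rw [← hg, antiAut_semilinearCoords, leftMulMatrix_eq_semilinearCoords σ b hw,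
      semilinearCoords_mul σ b hw h2, semilinearCoords_mul σ b hw h2]
    have : σ c ≠ 0 := by simpa using hc
    congr 2
    · simp [mul_comm]
    · simp [hc]

lemma mult_indChar_coxeterTorus_le_one [Finite F] (Φ : coxeterTorus b →* ℂˣ) {V : Type*}
    [AddCommGroup V] [Module ℂ V] [FiniteDimensional ℂ V]
    (π : Representation ℂ (GL (Fin 2) F) V) (hπ : π.IsIrreducible) :
    mult π (indChar (coxeterTorus b) Φ) ≤ 1 := by
  obtain ⟨σ, -, h2, hw⟩ := exists_frobenius (F := F) (E := E) (by simp [finrank_eq_card_basis b])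
  have := Fintype.ofFinite (coxeterTorus b)
  refine mult_indChar_le_one _ Φ π hπ (unitsAntiAut σ b hw h2)
    (fun g h => Units.ext (antiAut_mul σ b hw h2 g h)) ?_ (exists_conj_eq_unitsAntiAut σ b hw h2)
  rintro _ ⟨z, rfl⟩
  exact Units.ext (antiAut_leftMulMatrix σ b hw z)

/-- The matrix of an involutive automorphism of `E`, as an element of `GL(2, F)`. -/
def autUnit (h2 : ∀ z, σ (σ z) = z) : GL (Fin 2) F :=
  ⟨autMatrix σ b, autMatrix σ b, autMatrix_mul_self σ b h2, autMatrix_mul_self σ b h2⟩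

/-- The automorphism of `Eˣ` induced by an automorphism of `E`. -/
abbrev unitsAut : Eˣ ≃* Eˣ := Units.mapEquiv σ.toMulEquiv

lemma autUnit_mul_torusEquiv (h2 : ∀ z, σ (σ z) = z) (z : Eˣ) :
    autUnit σ b h2 * torusEquiv b z = torusEquiv b (unitsAut σ z) * autUnit σ b h2 :=
  Units.ext (autMatrix_mul_leftMulMatrix σ b z)

lemma mul_torusEquiv_eq_iff (hw : ∃ w, σ w ≠ w) (h2 : ∀ z, σ (σ z) = z) (x : GL (Fin 2) F)
    (w z : Eˣ) {a c : E} (hx : semilinearCoords σ b hw (a, c) = x) :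
    x * torusEquiv b w = torusEquiv b z * x ↔ a * w = a * z ∧ c * σ w = c * z := by
  rw [← Units.val_inj, Units.val_mul, Units.val_mul, coe_torusEquiv, coe_torusEquiv, ← hx,
    leftMulMatrix_eq_semilinearCoords σ b hw, leftMulMatrix_eq_semilinearCoords σ b hw,
    semilinearCoords_mul σ b hw h2, semilinearCoords_mul σ b hw h2, EmbeddingLike.apply_eq_iff_eq]
  simp [mul_comm]

/-- The torus is the centralizer of each of its non-scalar elements; this yields the count in
`card_intertwiners_of_ne`. -/
lemma commute_torusEquiv_iff (hw : ∃ w, σ w ≠ w) (h2 : ∀ z, σ (σ z) = z) (x : GL (Fin 2) F)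
    {z : Eˣ} (hz : σ z ≠ z) :
    x * torusEquiv b z = torusEquiv b z * x ↔ x ∈ coxeterTorus b := by
  obtain ⟨⟨a, c⟩, hx⟩ := (semilinearCoords σ b hw).surjective x
  constructor
  · rw [mul_torusEquiv_eq_iff σ b hw h2 x z z hx]
    rintro ⟨-, h⟩
    have hc : c = 0 := by
      by_contra hc
      exact hz (mul_left_cancel₀ hc h)
    have ha : a ≠ 0 := by
      rintro rfl
      apply x.ne_zero
      rw [← hx, hc]
      exact map_zero _
    refine ⟨Units.mk0 a ha, Units.ext ?_⟩
    rw [← hx, hc, ← leftMulMatrix_eq_semilinearCoords]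
    rfl
  · intro h
    obtain ⟨w, hw⟩ := (torusEquiv b).surjective ⟨x, h⟩
    have : x = torusEquiv b w := by rw [hw]
    rw [this, ← Subgroup.coe_mul, ← Subgroup.coe_mul, ← map_mul, ← map_mul, mul_comm]

/-! ### The character on the torus of the representation induced from it. -/

lemma card_intertwiners_of_ne [Fintype (GL (Fin 2) F)] [DecidableEq (GL (Fin 2) F)]
    [DecidableEq Eˣ] (hw : ∃ w, σ w ≠ w) (h2 : ∀ z, σ (σ z) = z) {z : Eˣ} (hz : σ z ≠ z) (w : Eˣ) :
    Fintype.card {x : GL (Fin 2) F // x * torusEquiv b w = torusEquiv b z * x} =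
      (if w = z then Nat.card Eˣ else 0) + (if w = unitsAut σ z then Nat.card Eˣ else 0) := by
  have hz' : z ≠ unitsAut σ z := fun h => hz (congrArg Units.val h).symm
  have hcent : Fintype.card {x : GL (Fin 2) F // x * torusEquiv b z = torusEquiv b z * x} =
      Nat.card Eˣ := by
    rw [Fintype.card_eq_nat_card, Nat.card_congr (torusEquiv b).toEquiv]
    exact Nat.card_congr (Equiv.subtypeEquivRight fun x => commute_torusEquiv_iff σ b hw h2 x hz)
  by_cases h : w = z
  · subst h
    rw [hcent, if_pos rfl, if_neg hz', add_zero]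
  by_cases h' : w = unitsAut σ z
  · rw [if_neg h, if_pos h', zero_add, ← hcent, h']
    -- Right multiplication by the matrix of `σ` reduces the case `w = σ z` to the centralizer of
    -- `z`.
    refine Fintype.card_congr ((Equiv.mulRight (autUnit σ b h2)).subtypeEquiv fun x => ?_)
    rw [Equiv.coe_mulRight, mul_assoc, autUnit_mul_torusEquiv, ← mul_assoc, ← mul_assoc,
      mul_left_inj]
  · rw [if_neg h, if_neg h', Fintype.card_eq_zero_iff]
    refine ⟨fun ⟨x, hx⟩ => ?_⟩
    obtain ⟨⟨a, c⟩, hac⟩ := (semilinearCoords σ b hw).surjective x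
    obtain ⟨h3, h4⟩ := (mul_torusEquiv_eq_iff σ b hw h2 x w z hac).1 hx
    have ha : a = 0 := by
      by_contra ha
      exact h (Units.ext (mul_left_cancel₀ ha h3))
    have hc : c = 0 := by
      by_contra hc
      refine h' (Units.ext ?_)
      have := congrArg σ (mul_left_cancel₀ hc h4)
      rwa [h2] at this
    apply x.ne_zero
    rw [← hac, ha, hc]
    exact map_zero _

lemma torusEquiv_algebraMap_comm (a : Fˣ) (x : GL (Fin 2) F) :
    x * torusEquiv b (Units.map (algebraMap F E) a) =
      torusEquiv b (Units.map (algebraMap F E) a) * x := by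
  refine Units.ext ?_
  simp only [Units.val_mul, coe_torusEquiv, Units.coe_map, MonoidHom.coe_coe, AlgHom.commutes]
  exact (Algebra.commutes _ _).symm

lemma card_intertwiners_algebraMap [Fintype (GL (Fin 2) F)] [DecidableEq (GL (Fin 2) F)]
    [DecidableEq Eˣ] (a : Fˣ) (w : Eˣ) :
    Fintype.card {x : GL (Fin 2) F //
        x * torusEquiv b w = torusEquiv b (Units.map (algebraMap F E) a) * x} =
      if w = Units.map (algebraMap F E) a then Nat.card (GL (Fin 2) F) else 0 := by
  have h (x : GL (Fin 2) F) :
      x * torusEquiv b w = torusEquiv b (Units.map (algebraMap F E) a) * x ↔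
        w = Units.map (algebraMap F E) a := by
    rw [← torusEquiv_algebraMap_comm, mul_right_inj, SetLike.coe_eq_coe,
      EmbeddingLike.apply_eq_iff_eq]
  split_ifs with hw
  · rw [Fintype.card_eq_nat_card]
    exact Nat.card_congr (Equiv.subtypeUnivEquiv fun x => (h x).2 hw)
  · exact Fintype.card_eq_zero_iff.2 ⟨fun x => hw ((h x.1).1 x.2)⟩

/-- The action of `Eˣ` on `GL(2, F)` by right multiplication by elements of the Coxeter torus. -/
def torusRightMul : Eˣ →* Equiv.Perm (GL (Fin 2) F) where
  toFun z := Equiv.mulRight (torusEquiv b z : GL (Fin 2) F)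
  map_one' := by ext1; simp
  map_mul' z w := by
    ext1 x
    rw [mul_comm z]
    simp [mul_assoc]

/-- The representation induced from the character `Φ⁻¹` of the Coxeter torus, on the functions on
`GL(2, F)` that are equivariant under right multiplication. -/
def torusInduced (Φ : coxeterTorus b →* ℂˣ) :
    Representation ℂ (GL (Fin 2) F)
      (equivariantFun (torusRightMul b) (Φ.comp (torusEquiv b).toMonoidHom)) :=
  equivariantRep (MulAction.toPermHom (GL (Fin 2) F) (GL (Fin 2) F)) _ _ fun g z => by
    ext1 x
    simp [torusRightMul, mul_assoc]

lemma character_torusInduced [Finite F] [Fintype Eˣ] [Fintype (GL (Fin 2) F)]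
    [DecidableEq (GL (Fin 2) F)] (Φ : coxeterTorus b →* ℂˣ) (g : GL (Fin 2) F) :
    (torusInduced b Φ).character g = (Nat.card Eˣ : ℂ)⁻¹ *
      ∑ w : Eˣ, ((Φ (torusEquiv b w))⁻¹ : ℂˣ) *
        (Fintype.card {x : GL (Fin 2) F // x * torusEquiv b w = g * x} : ℂ) :=
  character_equivariantRep _ _ _ _ g

lemma character_torusInduced_of_ne [Finite F] (hw : ∃ w, σ w ≠ w) (h2 : ∀ z, σ (σ z) = z)
    (Φ : coxeterTorus b →* ℂˣ) {z : Eˣ} (hz : σ z ≠ z) :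
    (torusInduced b Φ).character (torusEquiv b z) =
      ((Φ (torusEquiv b z))⁻¹ : ℂˣ) + ((Φ (torusEquiv b (unitsAut σ z)))⁻¹ : ℂˣ) := by
  classical
  have := Module.Finite.of_basis b
  have : Finite E := Module.finite_of_finite F
  have := Fintype.ofFinite Eˣ
  have := Fintype.ofFinite (GL (Fin 2) F)
  rw [character_torusInduced]
  simp only [card_intertwiners_of_ne σ b hw h2 hz, Nat.cast_add, Nat.cast_ite, Nat.cast_zero,
    mul_add, mul_ite, mul_zero, Finset.sum_add_distrib, Finset.sum_ite_eq', Finset.mem_univ,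
    if_true]
  have : (Nat.card Eˣ : ℂ) ≠ 0 := by simp
  field_simp

lemma character_torusInduced_algebraMap [Finite F] (Φ : coxeterTorus b →* ℂˣ) (a : Fˣ) :
    (torusInduced b Φ).character (torusEquiv b (Units.map (algebraMap F E) a)) =
      (Nat.card F ^ 2 - Nat.card F) *
        ((Φ (torusEquiv b (Units.map (algebraMap F E) a)))⁻¹ : ℂˣ) := by
  classical
  have := Module.Finite.of_basis b
  have : Finite E := Module.finite_of_finite F
  have := Fintype.ofFinite Eˣ
  have := Fintype.ofFinite F
  have := Fintype.ofFinite (GL (Fin 2) F)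
  have hq : 1 < Nat.card F := Finite.one_lt_card
  have hE : Nat.card Eˣ = Nat.card F ^ 2 - 1 := by
    rw [Nat.card_units, Module.natCard_eq_pow_finrank (K := F), finrank_eq_card_basis b,
      Fintype.card_fin]
  have hG : Nat.card (GL (Fin 2) F) = (Nat.card F ^ 2 - 1) * (Nat.card F ^ 2 - Nat.card F) := by
    rw [Matrix.card_GL_field, ← Nat.card_eq_fintype_card]
    simp
  have h1 : 1 < Nat.card F ^ 2 := Nat.one_lt_pow two_ne_zero hq
  have hn : (Nat.card Eˣ : ℂ) ≠ 0 := by simp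
  rw [character_torusInduced]
  simp only [card_intertwiners_algebraMap, Nat.cast_ite, Nat.cast_zero, mul_ite, mul_zero,
    Finset.sum_ite_eq', Finset.mem_univ, if_true]
  rw [hG, ← hE, Nat.cast_mul, Nat.cast_sub (Nat.le_self_pow two_ne_zero _)]
  push_cast
  field_simp

/-! ### The principal series representation and its character on the torus. -/

/-- The action of `GL(2, F)` on the nonzero vectors. -/
def nonzeroAction (F : Type*) [Field F] :
    GL (Fin 2) F →* Equiv.Perm {v : Fin 2 → F // v ≠ 0} where
  toFun g :=
    { toFun := fun v => ⟨g.val *ᵥ v, fun h => v.2 <| by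
        simpa only [Matrix.mulVec_mulVec, Units.inv_mul, Matrix.one_mulVec, Matrix.mulVec_zero]
          using congrArg (fun u => g⁻¹.val *ᵥ u) h⟩
      invFun := fun v => ⟨g⁻¹.val *ᵥ v, fun h => v.2 <| by
        simpa only [Matrix.mulVec_mulVec, Units.mul_inv, Matrix.one_mulVec, Matrix.mulVec_zero]
          using congrArg (fun u => g.val *ᵥ u) h⟩
      left_inv := fun v => Subtype.ext <| by
        simp only [Matrix.mulVec_mulVec, Units.inv_mul, Matrix.one_mulVec]
      right_inv := fun v => Subtype.ext <| by
        simp only [Matrix.mulVec_mulVec, Units.mul_inv, Matrix.one_mulVec] }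
  map_one' := by
    ext1 v
    exact Subtype.ext (Matrix.one_mulVec _)
  map_mul' g h := by
    ext1 v
    exact Subtype.ext (Matrix.mulVec_mulVec v.1 g.val h.val).symm

/-- The representation on the functions on `F² ∖ {0}` that are homogeneous for the restriction of
`Φ` to the scalars: a principal series representation. -/
def homogeneousRep (Φ : coxeterTorus b →* ℂˣ) :
    Representation ℂ (GL (Fin 2) F)
      (equivariantFun
        ((nonzeroAction F).comp ((coxeterTorus b).subtype.comp
          ((torusEquiv b).toMonoidHom.comp (Units.map (algebraMap F E).toMonoidHom))))
        (Φ.comp ((torusEquiv b).toMonoidHom.comp (Units.map (algebraMap F E).toMonoidHom)))) :=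
  equivariantRep (nonzeroAction F) _ _ fun g a => by
    rw [commute_iff_eq]
    simp only [MonoidHom.comp_apply]
    rw [← map_mul, ← map_mul]
    exact congrArg _ (torusEquiv_algebraMap_comm b a g)

/-- The difference of distinct elements of `E` is invertible, so the torus acts freely on nonzero
vectors. -/
lemma nonzeroAction_torusEquiv_eq_iff (z w : Eˣ) (v : {v : Fin 2 → F // v ≠ 0}) :
    nonzeroAction F (torusEquiv b w) v = nonzeroAction F (torusEquiv b z) v ↔ w = z := by
  refine ⟨fun h => ?_, fun h => h ▸ rfl⟩
  by_contra hne
  have h1 : Algebra.leftMulMatrix b (w : E) *ᵥ v.1 = Algebra.leftMulMatrix b (z : E) *ᵥ v.1 :=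
    congrArg Subtype.val h
  have h2 : Algebra.leftMulMatrix b (w - z : E) *ᵥ v.1 = 0 := by
    rw [map_sub, Matrix.sub_mulVec, h1, sub_self]
  have h3 : (w - z : E) ≠ 0 := sub_ne_zero.2 fun h => hne (Units.ext h)
  apply v.2
  have := congrArg (fun u => Algebra.leftMulMatrix b (w - z : E)⁻¹ *ᵥ u) h2
  simpa only [Matrix.mulVec_mulVec, ← map_mul, inv_mul_cancel₀ h3, map_one, Matrix.one_mulVec,
    Matrix.mulVec_zero] using this

lemma character_homogeneousRep [Fintype F] [DecidableEq F] [DecidableEq Eˣ]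
    (Φ : coxeterTorus b →* ℂˣ) (z : Eˣ) :
    (homogeneousRep b Φ).character (torusEquiv b z) = (Nat.card Fˣ : ℂ)⁻¹ *
      ∑ a : Fˣ, ((Φ (torusEquiv b (Units.map (algebraMap F E).toMonoidHom a)))⁻¹ : ℂˣ) *
        (if Units.map (algebraMap F E).toMonoidHom a = z then (Nat.card F ^ 2 - 1 : ℂ) else 0) := by
  refine (character_equivariantRep _ _ _ _ _).trans ?_
  congr 1
  refine Finset.sum_congr rfl fun a _ => ?_
  congr 1
  have h (v : {v : Fin 2 → F // v ≠ 0}) :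
      ((nonzeroAction F).comp ((coxeterTorus b).subtype.comp
        ((torusEquiv b).toMonoidHom.comp (Units.map (algebraMap F E).toMonoidHom)))) a v =
          nonzeroAction F (torusEquiv b z) v ↔ Units.map (algebraMap F E).toMonoidHom a = z :=
    nonzeroAction_torusEquiv_eq_iff b z (Units.map (algebraMap F E).toMonoidHom a) v
  split_ifs with hz
  · rw [Fintype.card_eq_nat_card, Nat.card_congr (Equiv.subtypeUnivEquiv fun v => (h v).2 hz),
      ← Fintype.card_eq_nat_card, Fintype.card_subtype_compl]
    have hq : 1 ≤ Fintype.card F ^ 2 := Nat.one_le_pow _ _ Fintype.card_pos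
    simp [Nat.card_eq_fintype_card, Nat.cast_sub hq]
  · rw [Fintype.card_eq_zero_iff.2 ⟨fun x => hz ((h x.1).1 x.2)⟩, Nat.cast_zero]

lemma character_homogeneousRep_algebraMap [Finite F] (Φ : coxeterTorus b →* ℂˣ) (a : Fˣ) :
    (homogeneousRep b Φ).character (torusEquiv b (Units.map (algebraMap F E) a)) =
      (Nat.card F + 1) * ((Φ (torusEquiv b (Units.map (algebraMap F E) a)))⁻¹ : ℂˣ) := by
  classical
  have := Fintype.ofFinite F
  have hq : 1 < Nat.card F := Finite.one_lt_card
  have hn : (Nat.card F : ℂ) - 1 ≠ 0 := sub_ne_zero.2 (by exact_mod_cast hq.ne')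
  have hinj : Function.Injective (Units.map (algebraMap F E).toMonoidHom) :=
    Units.map_injective (algebraMap F E).injective
  rw [character_homogeneousRep]
  have h (c : Fˣ) : Units.map (algebraMap F E).toMonoidHom c = Units.map (algebraMap F E) a ↔
      c = a := hinj.eq_iff
  simp only [h, mul_ite, mul_zero, Finset.sum_ite_eq', Finset.mem_univ, if_true]
  rw [Nat.card_units, Nat.cast_sub hq.le, Nat.cast_one]
  field_simp
  simp only [RingHom.toMonoidHom_eq_coe]
  ring

lemma character_homogeneousRep_of_ne [Finite F] (Φ : coxeterTorus b →* ℂˣ) {z : Eˣ}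
    (hz : σ z ≠ z) : (homogeneousRep b Φ).character (torusEquiv b z) = 0 := by
  classical
  have := Fintype.ofFinite F
  rw [character_homogeneousRep, Finset.sum_eq_zero, mul_zero]
  intro a _
  rw [if_neg, mul_zero]
  rintro rfl
  exact hz (σ.commutes a)

/-- Off the scalars the principal series vanishes. On scalars `z ^ q = z`, and the identity reads
`(q² - q) - (q - 2)(q + 1) = 2`; the natural subtraction is harmless since `q ≥ 2`. -/
lemma character_torusInduced_sub [Finite F] (hσ : ∀ z, σ z = z ^ Nat.card F)
    (hw : ∃ w, σ w ≠ w) (h2 : ∀ z, σ (σ z) = z) (Φ : coxeterTorus b →* ℂˣ)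
    (k : coxeterTorus b) :
    (torusInduced b Φ).character k - (Nat.card F - 2 : ℕ) * (homogeneousRep b Φ).character k =
      (((Φ k)⁻¹ : ℂˣ) + ((Φ k ^ Nat.card F)⁻¹ : ℂˣ) : ℂ) := by
  obtain ⟨z, rfl⟩ := (torusEquiv b).surjective k
  have hpow : unitsAut σ z = z ^ Nat.card F := Units.ext (hσ z)
  rw [← map_pow, ← map_pow, ← hpow]
  by_cases hz : σ z = z
  · have hz' : unitsAut σ z = z := Units.ext hz
    obtain ⟨a, ha⟩ := exists_algebraMap_eq σ (by simp [finrank_eq_card_basis b]) hw hz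
    have ha0 : a ≠ 0 := by
      rintro rfl
      exact z.ne_zero (by rw [← ha, map_zero])
    have hza : z = Units.map (algebraMap F E) (Units.mk0 a ha0) := Units.ext ha.symm
    rw [hz', hza, character_torusInduced_algebraMap, character_homogeneousRep_algebraMap,
      Nat.cast_sub Finite.one_lt_card]
    push_cast
    ring
  · rw [character_torusInduced_of_ne σ b hw h2 Φ hz, character_homogeneousRep_of_ne σ b Φ hz,
      mul_zero, sub_zero]

/-- On the torus `k ↦ k ^ q` is a bijection given by conjugation with the matrix of `σ`, which
leaves the character of `π` unchanged. -/
lemma sum_inv_pow_mul_character [Finite F] [Fintype (coxeterTorus b)]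
    (Φ : coxeterTorus b →* ℂˣ) {V : Type*} [AddCommGroup V] [Module ℂ V]
    (π : Representation ℂ (GL (Fin 2) F) V) :
    ∑ k : coxeterTorus b, (((Φ k ^ Nat.card F)⁻¹ : ℂˣ) : ℂ) * π.character k =
      ∑ k : coxeterTorus b, (((Φ k)⁻¹ : ℂˣ) : ℂ) * π.character k := by
  obtain ⟨σ, hσ, h2, hw⟩ :=
    exists_frobenius (F := F) (E := E) (by simp [finrank_eq_card_basis b])
  refine Fintype.sum_equiv
    (((torusEquiv b).symm.trans (unitsAut σ)).trans (torusEquiv b)).toEquiv _ _ fun k => ?_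
  obtain ⟨z, rfl⟩ := (torusEquiv b).surjective k
  have hpow : unitsAut σ z = z ^ Nat.card F := Units.ext (hσ z)
  have hconj := eq_mul_inv_of_mul_eq (autUnit_mul_torusEquiv σ b h2 z).symm
  simp only [MulEquiv.toEquiv_eq_coe, MulEquiv.coe_toEquiv, MulEquiv.trans_apply,
    MulEquiv.symm_apply_apply]
  rw [hconj, Representation.char_conj, hpow, map_pow, map_pow]

end Quadratic

/-! ### The virtual representations and the averaging formula. -/

/-- On the Coxeter torus, `Φ⁻¹ + Φ⁻ᵠ` is the character of the representation induced from `Φ⁻¹` minus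
`q - 2` copies of a principal series representation; tensoring with `π` gives `ψ₁` and `ψ₂`. -/
lemma exists_virtualRep_factor {F E : Type*} [Field F] [Finite F] [Field E] [Algebra F E]
    (b : Basis (Fin 2) F E) (Φ : coxeterTorus b →* ℂˣ) {V : Type*} [AddCommGroup V] [Module ℂ V]
    [FiniteDimensional ℂ V] (π : Representation ℂ (Matrix.GeneralLinearGroup (Fin 2) F) V) :
    ∃ ψ₁ ψ₂ : VirtualRep (Matrix.GeneralLinearGroup (Fin 2) F), ∀ k : coxeterTorus b,
      (((Φ k)⁻¹ : ℂˣ) + ((Φ k ^ Nat.card F)⁻¹ : ℂˣ) : ℂ) * π.character k =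
        ψ₁.character k + ψ₂.character k := by
  obtain ⟨σ, hσ, h2, hw⟩ :=
    exists_frobenius (F := F) (E := E) (by simp [finrank_eq_card_basis b])
  -- `U₀` is the zero representation; it fills the empty half of each formal difference.
  obtain ⟨U₀, h₀⟩ := exists_fdRep_character
    (Representation.trivial ℂ (Matrix.GeneralLinearGroup (Fin 2) F) (Fin 0 → ℂ))
  obtain ⟨U₁, h₁⟩ := exists_fdRep_character (π.tprod (torusInduced b Φ))
  obtain ⟨U₂, h₂⟩ := exists_fdRep_character ((π.tprod (homogeneousRep b Φ)).tprod
    (Representation.trivial ℂ (Matrix.GeneralLinearGroup (Fin 2) F) (Fin (Nat.card F - 2) → ℂ)))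
  have htriv (n : ℕ) (g : Matrix.GeneralLinearGroup (Fin 2) F) :
      (Representation.trivial ℂ (Matrix.GeneralLinearGroup (Fin 2) F) (Fin n → ℂ)).character g =
        n := by
    exact (LinearMap.trace_id ℂ (Fin n → ℂ)).trans (by rw [finrank_fin_fun])
  refine ⟨⟨U₁, U₀⟩, ⟨U₀, U₂⟩, fun k => ?_⟩
  simp only [VirtualRep.character, h₀, h₁, h₂, Representation.char_tensor, Pi.mul_apply, htriv,
    ← character_torusInduced_sub σ b hσ hw h2 Φ k]
  push_cast
  ring

lemma virtualRep_mult_indChar_one {G : Type*} [Group G] [Finite G] (K : Subgroup G) [Fintype K]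
    (ψ : VirtualRep G) :
    (ψ.mult (indChar K 1) : ℂ) = (Nat.card K : ℂ)⁻¹ * ∑ k : K, ψ.character k := by
  have h (U : FDRep ℂ G) : (CoxeterTorus.mult U.ρ (indChar K 1) : ℂ) =
      (Nat.card K : ℂ)⁻¹ * ∑ k : K, U.character k := by
    refine (mult_indChar_eq_sum K 1 U.ρ).trans ?_
    congr 1
    refine Finset.sum_congr rfl fun k _ => ?_
    simp only [MonoidHom.one_apply, inv_one, Units.val_one, one_mul]
    rfl
  rw [VirtualRep.mult, Int.cast_sub, Int.cast_natCast, Int.cast_natCast, h, h, ← mul_sub,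
    ← Finset.sum_sub_distrib]
  rfl

end CoxeterTorus

end

theorem mainTheorem1 {F E : Type*} [Field F] [Finite F] [Field E]
    [Algebra F E] (b : Module.Basis (Fin 2) F E)
    (Φ : CoxeterTorus.coxeterTorus b →* ℂˣ) :
    CoxeterTorus.IsMultiplicityFree.{w}
        (CoxeterTorus.indChar (CoxeterTorus.coxeterTorus b) Φ) ∧
      ∀ (V : Type w) [AddCommGroup V] [Module ℂ V] [FiniteDimensional ℂ V]
        (π : Representation ℂ (Matrix.GeneralLinearGroup (Fin 2) F) V), π.IsIrreducible →
        ∃ ψ₁ ψ₂ : CoxeterTorus.VirtualRep (Matrix.GeneralLinearGroup (Fin 2) F),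
          (∀ k : CoxeterTorus.coxeterTorus b,
            (((Φ k)⁻¹ : ℂˣ) + ((Φ k ^ Nat.card F)⁻¹ : ℂˣ) : ℂ) * π.character k =
              ψ₁.character k + ψ₂.character k) ∧
          (CoxeterTorus.mult π (CoxeterTorus.indChar (CoxeterTorus.coxeterTorus b) Φ) : ℚ) =
            ((ψ₁.mult (CoxeterTorus.indChar (CoxeterTorus.coxeterTorus b) 1) : ℚ) +
              (ψ₂.mult (CoxeterTorus.indChar (CoxeterTorus.coxeterTorus b) 1) : ℚ)) / 2 := by
  refine ⟨fun V _ _ _ π hπ => CoxeterTorus.mult_indChar_coxeterTorus_le_one b Φ π hπ,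
    fun V _ _ _ π _ => ?_⟩
  obtain ⟨ψ₁, ψ₂, h⟩ := CoxeterTorus.exists_virtualRep_factor b Φ π
  refine ⟨ψ₁, ψ₂, h, ?_⟩
  have := Fintype.ofFinite (CoxeterTorus.coxeterTorus b)
  rw [← Rat.cast_inj (α := ℂ)]
  push_cast
  rw [CoxeterTorus.virtualRep_mult_indChar_one, CoxeterTorus.virtualRep_mult_indChar_one,
    CoxeterTorus.mult_indChar_eq_sum, ← mul_add, ← Finset.sum_add_distrib,
    ← Finset.sum_congr rfl fun k _ => h k]
  simp only [add_mul, Finset.sum_add_distrib]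
  rw [CoxeterTorus.sum_inv_pow_mul_character]
  ring
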